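/- Let $K$ be a field and let $n_1<n_2<n_3<n_4$ be positive integers with $\gcd(n_1,n_2,n_3,n_4)=1$. Let $I(C)$ be the toric ideal of the monomial curve $C:\ x_i=t^{n_i}$ $(1\le i\le 4)$, i.e. the kernel of the $K$-algebra homomorphism $K[x_1,x_2,x_3,x_4]\to K[t]$, $x_i\mapsto t^{n_i}$. For a nonzero polynomial $f$ let $f_*$ be its nonzero homogeneous summand of least degree, and let $I(C)_*$ be the ideal generated by the $f_*$ with $0\ne f\in I(C)$. Assume that $C$ has Cohen–Macaulay tangent cone at the origin, i.e. that the ring $K[x_1,x_2,x_3,x_4]/I(C)_*$ is Cohen–Macaulay. Suppose that $I(C)$ is minimally generated by $$f_1=x_1^{a_1}-x_2^{a_{12}}x_4^{a_{14}},\quad f_2=x_2^{a_2}-x_3^{a_{23}}x_4^{a_{24}},\quad f_3=x_3^{a_3}-x_1^{a_{31}}x_2^{a_{32}},$$ $$f_4=x_4^{a_4}-x_1^{a_{41}}x_3^{a_{43}},\quad f_5=x_1^{a_{31}}x_4^{a_{24}}-x_2^{a_{12}}x_3^{a_{43}},$$ where $0<a_{ij}<a_j$ for all the exponents $a_{ij}$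 that occur, and that $a_{43}\le a_{23}$ (case 3(b) with $a_{43}\le a_{23}$). Here "minimally generated" means: generated, with no generator redundant. A finite set $G\subset I(C)$ is called a standard basis of $I(C)$ if the leading monomials of the nonzero elements of $G$ and those of the nonzero elements of $I(C)$ generate the same ideal, with respect to the negative degree reverse lexicographic term ordering with $x_4>x_3>x_2>x_1$: one has $x^\alpha<x^\beta$ if $\deg x^\alpha>\deg x^\beta$, or if the degrees are equal and $\alpha_i>\beta_i$ for the least index $i$ with $\alpha_i\ne\beta_i$. (i) If $a_{24}<a_{14}$, put $$f_6=x_2^{a_2+a_{12}}-x_1^{a_{31}}x_3^{a_{23}-a_{43}}x_4^{2a_{24}},\qquad D=a_{31}+a_{23}-a_{43}+2a_{24}.$$ (ii) If $a_{14}\le a_{24}$, put $$f_6=x_2^{a_2+a_{12}}-x_1^{a_1}x_3^{a_{23}}x_4^{a_{24}-a_{14}},\qquad D=a_1+a_{23}+a_{24}-a_{14}.$$ In each of the two subcases, $\{f_1,\dots,f_6\}$ is a standard basis of $I(C)$. Moreover, in each of the two subcases and in each of the eight cases given by the choice of one relation from each of the three pairs $$a_3<a_{31}+a_{32}\ \text{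 or }\ a_3=a_{31}+a_{32};\qquad a_2+a_{12}<D\ \text{ or }\ a_2+a_{12}=D;\qquad a_{12}+a_{43}<a_{31}+a_{24}\ \text{ or }\ a_{12}+a_{43}=a_{31}+a_{24},$$ the ideal $I(C)_*$ is minimally generated by the six polynomials $$x_2^{a_{12}}x_4^{a_{14}},\quad x_3^{a_{23}}x_4^{a_{24}},\quad x_3^{a_3},\quad x_4^{a_4},\quad g_5,\quad g_6,$$ where $g_5=x_2^{a_{12}}x_3^{a_{43}}$ if $a_{12}+a_{43}<a_{31}+a_{24}$ and $g_5=f_5$ if $a_{12}+a_{43}=a_{31}+a_{24}$, while $g_6=x_2^{a_2+a_{12}}$ if $a_2+a_{12}<D$ and $g_6=f_6$ if $a_2+a_{12}=D$. (The four cases with $a_3=a_{31}+a_{32}$ are listed for completeness: they do not occur, because $n_1<n_2<n_3$.) -/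

import Mathlib

open MvPolynomial

/-! ## The toric ideal of a monomial curve and its tangent cone -/

/-- The toric ideal `I(C)` of the affine monomial curve `x_i = t ^ (n i)`: the kernel of the
`K`-algebra homomorphism `K[x_i] → K[t]`, `x_i ↦ t ^ (n i)`. -/
noncomputable def toricIdeal (K : Type*) [Field K] {d : ℕ} (n : Fin d → ℕ) :
    Ideal (MvPolynomial (Fin d) K) :=
  RingHom.ker
    (aeval (fun i => (Polynomial.X : Polynomial K) ^ n i) :
      MvPolynomial (Fin d) K →ₐ[K] Polynomial K)

/-- `f_*`: the nonzero homogeneous summand of `f` of least degree (and `0` if `f = 0`). -/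
noncomputable def leastForm {K : Type*} [Field K] {d : ℕ} (f : MvPolynomial (Fin d) K) :
    MvPolynomial (Fin d) K :=
  homogeneousComponent (sInf {k : ℕ | homogeneousComponent k f ≠ 0}) f

/-- `I_*`: the ideal generated by the `f_*` for `f ∈ I`. -/
noncomputable def leastFormIdeal {K : Type*} [Field K] {d : ℕ}
    (I : Ideal (MvPolynomial (Fin d) K)) : Ideal (MvPolynomial (Fin d) K) :=
  Ideal.span (leastForm '' (I : Set (MvPolynomial (Fin d) K)))

/-! ## Minimal generating sets -/

/-- The elements `g i` generate `I`, and none of them is redundant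
(in particular they are pairwise distinct). -/
def IsMinimallyGeneratedBy {R : Type*} [CommRing R] (I : Ideal R) {m : ℕ} (g : Fin m → R) : Prop :=
  I = Ideal.span (Set.range g) ∧ ∀ i, g i ∉ Ideal.span (g '' {j | j ≠ i})

/-! ## Standard bases for the negative degree reverse lexicographic ordering -/

/-- `x ^ α < x ^ β` in the negative degree reverse lexicographic ordering on the monomials in
`x_1, …, x_d` with `x_d > ⋯ > x_2 > x_1` (the variable `x_{i+1}` has index `i : Fin d`):
monomials of larger degree are smaller, and for monomials of equal degree the smaller one is the
one with the larger exponent at the first variable, in the order `x_1, x_2, …`,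
at which the two exponents differ. -/
def negDegRevLexLT {d : ℕ} (α β : Fin d →₀ ℕ) : Prop :=
  β.degree < α.degree ∨
    (α.degree = β.degree ∧ ∃ i, β i < α i ∧ ∀ j < i, α j = β j)

/-- `x ^ α` is the leading monomial of `f`. -/
def IsLeadingExponent {K : Type*} [Field K] {d : ℕ} (f : MvPolynomial (Fin d) K)
    (α : Fin d →₀ ℕ) : Prop :=
  α ∈ f.support ∧ ∀ β ∈ f.support, β ≠ α → negDegRevLexLT β α

/-- The leading ideal `L(S)`: the ideal generated by the leading monomials of the nonzero
elements of `S`. -/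
noncomputable def leadingIdeal {K : Type*} [Field K] {d : ℕ} (S : Set (MvPolynomial (Fin d) K)) :
    Ideal (MvPolynomial (Fin d) K) :=
  Ideal.span {p | ∃ f ∈ S, ∃ α, IsLeadingExponent f α ∧ p = monomial α 1}

/-- `G` is a standard basis of `I` with respect to the negative degree reverse lexicographic
ordering: `G` is a finite subset of `I` and `L(G) = L(I)`. Elements of the extension of `I` to the
localization of `K[x]` at the origin differ from elements of `I` by units with leading monomial
`1`, so `L(I)` is also the leading ideal of that extension. -/
def IsStandardBasis {K : Type*} [Field K] {d : ℕ} (G : Set (MvPolynomial (Fin d) K))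
    (I : Ideal (MvPolynomial (Fin d) K)) : Prop :=
  G.Finite ∧ G ⊆ (I : Set (MvPolynomial (Fin d) K)) ∧
    leadingIdeal G = leadingIdeal (I : Set (MvPolynomial (Fin d) K))

/-! ## Cohen-Macaulay rings -/

/-- A Noetherian local ring is Cohen-Macaulay if its maximal ideal contains a regular sequence
whose length is the Krull dimension (that is, its depth equals its dimension). -/
def IsLocalCohenMacaulay (R : Type*) [CommRing R] [IsLocalRing R] : Prop :=
  IsNoetherianRing R ∧
    ∃ rs : List R, (∀ r ∈ rs, r ∈ IsLocalRing.maximalIdeal R) ∧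
      RingTheory.Sequence.IsRegular R rs ∧ (rs.length : WithBot ℕ∞) = ringKrullDim R

/-- A Noetherian ring is Cohen-Macaulay if all its localizations at prime ideals are. -/
def IsCohenMacaulay (R : Type*) [CommRing R] : Prop :=
  IsNoetherianRing R ∧
    ∀ (p : Ideal R) [p.IsPrime], IsLocalCohenMacaulay (Localization.AtPrime p)

/-- The monomial curve given by `n` has Cohen-Macaulay tangent cone at the origin: the coordinate
ring `K[x] / I(C)_*` of the tangent cone is Cohen-Macaulay. -/
def HasCohenMacaulayTangentCone (K : Type*) [Field K] {d : ℕ} (n : Fin d → ℕ) : Prop :=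
  IsCohenMacaulay (MvPolynomial (Fin d) K ⧸ leastFormIdeal (toricIdeal K n))

/-! ## Case 3(b) -/

/-- `I(C)` is given as in case 3(b): all exponents satisfy `0 < a_{ij} < a_j`, and `I(C)` is
minimally generated by
`f_1 = x_1^{a_1} - x_2^{a_12} x_4^{a_14}`, `f_2 = x_2^{a_2} - x_3^{a_23} x_4^{a_24}`,
`f_3 = x_3^{a_3} - x_1^{a_31} x_2^{a_32}`, `f_4 = x_4^{a_4} - x_1^{a_41} x_3^{a_43}`,
`f_5 = x_1^{a_31} x_4^{a_24} - x_2^{a_12} x_3^{a_43}`.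
The variable `x_i` is `X (i - 1)`. -/
structure IsCase3b (K : Type*) [Field K] (n : Fin 4 → ℕ)
    (a₁ a₂ a₃ a₄ a₁₂ a₁₄ a₂₃ a₂₄ a₃₁ a₃₂ a₄₁ a₄₃ : ℕ) : Prop where
  h12 : 0 < a₁₂ ∧ a₁₂ < a₂
  h14 : 0 < a₁₄ ∧ a₁₄ < a₄
  h23 : 0 < a₂₃ ∧ a₂₃ < a₃
  h24 : 0 < a₂₄ ∧ a₂₄ < a₄
  h31 : 0 < a₃₁ ∧ a₃₁ < a₁
  h32 : 0 < a₃₂ ∧ a₃₂ < a₂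
  h41 : 0 < a₄₁ ∧ a₄₁ < a₁
  h43 : 0 < a₄₃ ∧ a₄₃ < a₃
  gen : IsMinimallyGeneratedBy (toricIdeal K n)
    ![X 0 ^ a₁ - X 1 ^ a₁₂ * X 3 ^ a₁₄,
      X 1 ^ a₂ - X 2 ^ a₂₃ * X 3 ^ a₂₄,
      X 2 ^ a₃ - X 0 ^ a₃₁ * X 1 ^ a₃₂,
      X 3 ^ a₄ - X 0 ^ a₄₁ * X 2 ^ a₄₃,
      X 0 ^ a₃₁ * X 3 ^ a₂₄ - X 1 ^ a₁₂ * X 2 ^ a₄₃]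

/-! ## Monomials, weights and the toric ideal -/

section Toric

variable {K : Type*} [Field K] {d : ℕ} {n : Fin d → ℕ}

/-! Read each of the six binomials as a rewriting rule `l → r` between two monomials of equal weight
`∑ α_i n_i`, where `l` is the leading monomial. Weight classes are finite, so rewriting stops at a
standard monomial, one divisible by no `l`. Both conclusions follow once each class is known to
contain at most one standard monomial. A monomial of `f ∈ I(C)` is never alone in its class; if the
leading one were standard, another one of its class would reduce to it and so be larger
(`leadingIdeal_eq`). Replacing all monomials of `f` by their normal forms gives zero, and rewriting
never lowers the degree, so `f_*` is a combination of multiples of the least forms of the `l - r`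
(`leastFormIdeal_le`).

Uniqueness (`IsCase3b.standard_unique`) is checked modulo `x_1`: an explicit normal form for `K[x] /
(I(C), x_1)` is respected by the five generators, hence constant on weight classes, and it fixes
every standard monomial without `x_1`. This rests on `a₄₃ ≤ a₂₃` and on `a₃ = a₂₃ + a₄₃`, `a₄ = a₁₄
+ a₂₄` (`IsCase3b.exponent_eq`).

The order of the `n_i` decides the leading monomials of `f_1, …, f_4`. For `f_5` and `f_6` the
Cohen–Macaulay hypothesis decides: were the side containing `x_1` of smaller degree, it would lie in
`I(C)_*`, and cancelling `x_1` (`exists_le_of_monomial_add_mem`) would leave a monomial that no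
monomial of a generator divides. Minimality holds because modulo `x_1` the six generators of
`I(C)_*` become, up to sign, monomials none of which divides another. -/

theorem aeval_curve_monomial (α : Fin d →₀ ℕ) (c : K) :
    aeval (fun i => (Polynomial.X : Polynomial K) ^ n i) (monomial α c) =
      Polynomial.monomial (Finsupp.weight n α) c := by
  rw [aeval_monomial, Finsupp.weight_apply, ← Polynomial.C_mul_X_pow_eq_monomial]
  simp only [← pow_mul, Finsupp.prod, Finsupp.sum, Finset.prod_pow_eq_pow_sum, smul_eq_mul]
  simp [mul_comm]

theorem monomial_sub_mem_toricIdeal {α β : Fin d →₀ ℕ}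
    (h : Finsupp.weight n α = Finsupp.weight n β) :
    (monomial α 1 - monomial β 1 : MvPolynomial (Fin d) K) ∈ toricIdeal K n := by
  rw [toricIdeal, RingHom.mem_ker, map_sub]
  erw [aeval_curve_monomial, aeval_curve_monomial]
  rw [h, sub_self]

theorem weight_eq_of_mem_toricIdeal {α β : Fin d →₀ ℕ}
    (h : (monomial α 1 - monomial β 1 : MvPolynomial (Fin d) K) ∈ toricIdeal K n) :
    Finsupp.weight n α = Finsupp.weight n β := by
  rw [toricIdeal, RingHom.mem_ker, map_sub, sub_eq_zero] at h
  erw [aeval_curve_monomial, aeval_curve_monomial] at h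
  exact ((Polynomial.monomial_eq_monomial_iff).1 h).elim And.left fun h => absurd h.1 one_ne_zero

theorem sum_coeff_fiber_eq_zero {f : MvPolynomial (Fin d) K} (hf : f ∈ toricIdeal K n) (w : ℕ) :
    ∑ α ∈ f.support with Finsupp.weight n α = w, coeff α f = 0 := by
  rw [toricIdeal, RingHom.mem_ker] at hf
  have h := congrArg (fun p => Polynomial.coeff p w) hf
  rw [f.as_sum, map_sum] at h
  have e : ∀ α ∈ f.support, (aeval (fun i => (Polynomial.X : Polynomial K) ^ n i))
      (monomial α (coeff α f)) = Polynomial.monomial (Finsupp.weight n α) (coeff α f) :=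
    fun α _ => aeval_curve_monomial _ _
  erw [Finset.sum_congr rfl e] at h
  simpa [Polynomial.finsetSum_coeff, Polynomial.coeff_monomial, Finset.sum_filter] using h

theorem exists_ne_weight_eq {f : MvPolynomial (Fin d) K} (hf : f ∈ toricIdeal K n)
    {α : Fin d →₀ ℕ} (hα : α ∈ f.support) :
    ∃ β ∈ f.support, β ≠ α ∧ Finsupp.weight n β = Finsupp.weight n α := by
  by_contra! H
  have h := sum_coeff_fiber_eq_zero hf (Finsupp.weight n α)
  rw [Finset.sum_eq_single_of_mem α (by simpa using hα)] at h
  · exact (mem_support_iff.1 hα) h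
  · intro β hβ hne
    rw [Finset.mem_filter] at hβ
    exact absurd hβ.2 (H β hβ.1 hne)

/-- Within one weight class the coefficients of `f` sum to a coefficient of its image in `K[t]`,
which is zero. With `y` the normal form, this says that elements of the toric ideal have normal form
zero. -/
theorem sum_smul_eq_zero {M : Type*} [AddCommGroup M] [Module K M]
    {f : MvPolynomial (Fin d) K} (hf : f ∈ toricIdeal K n) (y : (Fin d →₀ ℕ) → M)
    (hy : ∀ α β, Finsupp.weight n α = Finsupp.weight n β → y α = y β) :
    ∑ α ∈ f.support, coeff α f • y α = 0 := by
  classical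
  rw [← Finset.sum_fiberwise_of_maps_to
    (fun α hα => Finset.mem_image_of_mem (Finsupp.weight n) hα)]
  refine Finset.sum_eq_zero fun w hw => ?_
  obtain ⟨α, -, rfl⟩ := Finset.mem_image.1 hw
  have e : ∀ β ∈ f.support.filter (fun β => Finsupp.weight n β = Finsupp.weight n α),
      coeff β f • y β = coeff β f • y α := fun β hβ => by
    rw [hy β α (Finset.mem_filter.1 hβ).2]
  rw [Finset.sum_congr rfl e, ← Finset.sum_smul, sum_coeff_fiber_eq_zero hf, zero_smul]

theorem finite_weight_eq (hpos : ∀ i, 0 < n i) (w : ℕ) :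
    {α : Fin d →₀ ℕ | Finsupp.weight n α = w}.Finite :=
  (Finsupp.finite_of_nat_weight_le n (fun i => (hpos i).ne') w).subset fun _ h => le_of_eq h

/-- A function on exponents compatible with a set of binomial generators of the toric ideal is
constant on the fibres of the weight. -/
theorem eq_of_weight_eq {ι τ : Type*} {u v : ι → (Fin d →₀ ℕ)}
    (hI : toricIdeal K n = Ideal.span (Set.range fun i => monomial (u i) 1 - monomial (v i) 1))
    (φ : (Fin d →₀ ℕ) → τ) (hφ : ∀ i m, φ (m + u i) = φ (m + v i)) {α β : Fin d →₀ ℕ}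
    (h : Finsupp.weight n α = Finsupp.weight n β) : φ α = φ β := by
  -- Send `x^α` to the basis vector indexed by `φ α`. This linear map kills all multiples of the
  -- generators, hence `x^α - x^β`.
  let Φ : MvPolynomial (Fin d) K →ₗ[K] (τ →₀ K) :=
    (basisMonomials (Fin d) K).constr K fun α => Finsupp.single (φ α) 1
  have hΦ : ∀ α, Φ (monomial α 1) = Finsupp.single (φ α) 1 := fun α => by
    have := (basisMonomials (Fin d) K).constr_basis K (fun α => Finsupp.single (φ α) (1 : K)) α
    rwa [coe_basisMonomials] at this
  have key : ∀ p ∈ toricIdeal K n, ∀ q, Φ (q * p) = 0 := by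
    rw [hI]
    intro p hp
    induction hp using Submodule.span_induction with
    | mem x hx =>
      obtain ⟨i, rfl⟩ := hx
      intro q
      rw [q.as_sum, Finset.sum_mul, map_sum]
      refine Finset.sum_eq_zero fun m _ => ?_
      have : (monomial m (coeff m q) : MvPolynomial (Fin d) K) * (monomial (u i) 1
          - monomial (v i) 1) =
          coeff m q • (monomial (m + u i) 1 - monomial (m + v i) 1) := by
        simp [mul_sub, monomial_mul, smul_sub, smul_monomial]
      rw [this, map_smul, map_sub, hΦ, hΦ, hφ, sub_self, smul_zero]
    | zero => simp
    | add x y _ _ hx hy => intro q; rw [mul_add, map_add, hx, hy, add_zero]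
    | smul a x _ hx => intro q; rw [smul_eq_mul, ← mul_assoc, hx]
  have h0 := key _ (monomial_sub_mem_toricIdeal h) 1
  rw [one_mul, map_sub, hΦ, hΦ, sub_eq_zero] at h0
  exact (Finsupp.single_left_inj one_ne_zero).1 h0

/-- An ideal generated by binomials lies in the ideal generated by their monomials. -/
theorem toricIdeal_le_span_monomial {ι : Type*} {u v : ι → (Fin d →₀ ℕ)}
    (hI : toricIdeal K n = Ideal.span (Set.range fun i => monomial (u i) 1 - monomial (v i) 1)) :
    toricIdeal K n ≤ Ideal.span ((fun s => monomial s (1 : K)) '' (Set.range u ∪ Set.range v)) := by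
  rw [hI, Ideal.span_le]
  rintro _ ⟨i, rfl⟩
  exact sub_mem (Ideal.subset_span ⟨_, Or.inl ⟨i, rfl⟩, rfl⟩)
    (Ideal.subset_span ⟨_, Or.inr ⟨i, rfl⟩, rfl⟩)

end Toric

/-! ## Least forms -/

section LeastForm

variable {K : Type*} [Field K] {d : ℕ}

theorem support_leastForm_subset (f : MvPolynomial (Fin d) K) :
    (leastForm f).support ⊆ f.support := by
  intro α hα
  rw [mem_support_iff, leastForm, coeff_homogeneousComponent] at hα
  split_ifs at hα with h
  · exact mem_support_iff.2 hα
  · exact absurd rfl hα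

theorem sInf_le_degree {f : MvPolynomial (Fin d) K} {α : Fin d →₀ ℕ} (hα : α ∈ f.support) :
    sInf {k : ℕ | homogeneousComponent k f ≠ 0} ≤ α.degree := by
  refine Nat.sInf_le fun h => mem_support_iff.1 hα ?_
  have := congrArg (coeff α) h
  rwa [coeff_homogeneousComponent, if_pos rfl] at this

theorem degree_eq_of_mem_support_leastForm {f : MvPolynomial (Fin d) K} {α : Fin d →₀ ℕ}
    (hα : α ∈ (leastForm f).support) :
    α.degree = sInf {k : ℕ | homogeneousComponent k f ≠ 0} := by
  by_contra h
  rw [mem_support_iff, leastForm, coeff_homogeneousComponent, if_neg h] at hα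
  exact hα rfl

theorem leastForm_eq_of_isHomogeneous {f g : MvPolynomial (Fin d) K} {k : ℕ}
    (hf : f.IsHomogeneous k) (hf0 : f ≠ 0) (hg : ∀ α ∈ g.support, k < α.degree) :
    leastForm (f + g) = f := by
  have hgk : ∀ j ≤ k, homogeneousComponent j g = 0 := fun j hj => by
    ext α
    rw [coeff_homogeneousComponent, coeff_zero]
    split_ifs with h
    · by_contra h0
      have := hg α (mem_support_iff.2 h0)
      omega
    · rfl
  have hk : homogeneousComponent k (f + g) = f := by
    rw [map_add, hgk k le_rfl, add_zero, homogeneousComponent_of_mem hf, if_pos rfl]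
  have hs : sInf {j : ℕ | homogeneousComponent j (f + g) ≠ 0} = k := by
    refine le_antisymm (Nat.sInf_le ?_) (le_csInf ⟨k, ?_⟩ fun j hj => ?_)
    · rw [Set.mem_ofPred_eq, hk]; exact hf0
    · rw [Set.mem_ofPred_eq, hk]; exact hf0
    · by_contra! hjk
      refine hj ?_
      rw [map_add, hgk j hjk.le, add_zero, homogeneousComponent_of_mem hf, if_neg hjk.ne]
  rw [leastForm, hs, hk]

theorem leastForm_mem {I : Ideal (MvPolynomial (Fin d) K)} {f : MvPolynomial (Fin d) K}
    (hf : f ∈ I) : leastForm f ∈ leastFormIdeal I :=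
  Ideal.subset_span ⟨f, hf, rfl⟩

theorem monomial_mem_leastFormIdeal {I : Ideal (MvPolynomial (Fin d) K)} {α β : Fin d →₀ ℕ}
    (h : monomial α 1 - monomial β 1 ∈ I) (hd : α.degree < β.degree) :
    monomial α 1 ∈ leastFormIdeal I := by
  have := leastForm_mem h
  rwa [sub_eq_add_neg, leastForm_eq_of_isHomogeneous (isHomogeneous_monomial 1 rfl)
    (by simp [monomial_eq_zero])] at this
  intro γ hγ
  rw [support_neg] at hγ
  rwa [Finset.mem_singleton.1 (support_monomial_subset hγ)]

theorem monomial_sub_mem_leastFormIdeal {I : Ideal (MvPolynomial (Fin d) K)} {α β : Fin d →₀ ℕ}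
    (h : monomial α 1 - monomial β 1 ∈ I) (hd : α.degree = β.degree) :
    monomial α 1 - monomial β 1 ∈ leastFormIdeal I := by
  by_cases h0 : (monomial α 1 - monomial β 1 : MvPolynomial (Fin d) K) = 0
  · rw [h0]; exact zero_mem _
  have := leastForm_mem h
  rwa [← add_zero (monomial α 1 - monomial β 1), leastForm_eq_of_isHomogeneous
    ((isHomogeneous_monomial 1 rfl).sub (isHomogeneous_monomial 1 hd.symm)) h0 (by simp)] at this

theorem leastFormIdeal_le_span_monomial {I : Ideal (MvPolynomial (Fin d) K)}
    {S : Set (Fin d →₀ ℕ)} (h : I ≤ Ideal.span ((fun s => monomial s (1 : K)) '' S)) :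
    leastFormIdeal I ≤ Ideal.span ((fun s => monomial s (1 : K)) '' S) := by
  rw [leastFormIdeal, Ideal.span_le]
  rintro _ ⟨f, hf, rfl⟩
  exact mem_ideal_span_monomial_image.2 fun α hα =>
    mem_ideal_span_monomial_image.1 (h hf) α (support_leastForm_subset f hα)

end LeastForm

/-! ## The negative degree reverse lexicographic ordering -/

section Order

variable {d : ℕ}

theorem negDegRevLexLT_iff (α β : Fin d →₀ ℕ) :
    negDegRevLexLT α β ↔
      toLex (β.degree, toLex (β : Fin d → ℕ)) < toLex (α.degree, toLex (α : Fin d → ℕ)) := by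
  rw [Prod.Lex.toLex_lt_toLex, negDegRevLexLT]
  refine or_congr Iff.rfl (and_congr eq_comm ?_)
  constructor
  · rintro ⟨i, hi, hj⟩
    exact ⟨i, fun j h => (hj j h).symm, hi⟩
  · rintro ⟨i, hj, hi⟩
    exact ⟨i, hi, fun j h => (hj j h).symm⟩

instance : IsStrictOrder (Fin d →₀ ℕ) negDegRevLexLT where
  irrefl α h := lt_irrefl _ ((negDegRevLexLT_iff α α).1 h)
  trans α β γ h h' := (negDegRevLexLT_iff α γ).2
    (((negDegRevLexLT_iff β γ).1 h').trans ((negDegRevLexLT_iff α β).1 h))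

theorem negDegRevLexLT.add_left {α β : Fin d →₀ ℕ} (h : negDegRevLexLT α β) (γ : Fin d →₀ ℕ) :
    negDegRevLexLT (γ + α) (γ + β) := by
  simp only [negDegRevLexLT, map_add, Finsupp.add_apply] at h ⊢
  rcases h with h | ⟨h, i, hi, hj⟩
  · exact Or.inl (by omega)
  · exact Or.inr ⟨by omega, i, by omega, fun j hji => by rw [hj j hji]⟩

theorem negDegRevLexLT.degree_le {α β : Fin d →₀ ℕ} (h : negDegRevLexLT α β) :
    β.degree ≤ α.degree := by
  rcases h with h | h
  · exact h.le
  · exact h.1.ge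

theorem isLeadingExponent_sub {K : Type*} [Field K] {α β : Fin d →₀ ℕ}
    (h : negDegRevLexLT β α) :
    IsLeadingExponent (monomial α 1 - monomial β 1 : MvPolynomial (Fin d) K) α := by
  classical
  have hne : β ≠ α := fun e => irrefl_of negDegRevLexLT α (by rwa [e] at h)
  constructor
  · simp [mem_support_iff, coeff_monomial, hne]
  · intro γ hγ hγα
    rw [mem_support_iff, coeff_sub, coeff_monomial, coeff_monomial, if_neg hγα.symm] at hγ
    have : β = γ := by
      by_contra h
      simp [h] at hγ
    rwa [← this]

theorem IsLeadingExponent.neg {K : Type*} [Field K] {f : MvPolynomial (Fin d) K} {α : Fin d →₀ ℕ}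
    (h : IsLeadingExponent f α) : IsLeadingExponent (-f) α := by
  simpa [IsLeadingExponent, support_neg] using h

end Order

/-! ## Reduction to standard monomials -/

section Reduction

variable {K : Type*} [Field K] {d : ℕ} {n : Fin d → ℕ} {ι : Type*} {l r : ι → (Fin d →₀ ℕ)}

/-- Every monomial reduces, modulo the rules `l i → r i`, to a standard one. -/
theorem exists_standard (hpos : ∀ i, 0 < n i)
    (hw : ∀ i, Finsupp.weight n (l i) = Finsupp.weight n (r i))
    (hlt : ∀ i, negDegRevLexLT (r i) (l i))
    {H : Ideal (MvPolynomial (Fin d) K)}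
    (hH : ∀ i, (l i).degree < (r i).degree → monomial (l i) 1 ∈ H)
    (hH' : ∀ i, (l i).degree = (r i).degree → monomial (l i) 1 - monomial (r i) 1 ∈ H)
    (α : Fin d →₀ ℕ) :
    ∃ γ, (∀ i, ¬ l i ≤ γ) ∧ Finsupp.weight n γ = Finsupp.weight n α ∧
      (γ = α ∨ negDegRevLexLT γ α) ∧ (α.degree < γ.degree → monomial α 1 ∈ H) ∧
      (α.degree = γ.degree → monomial α 1 - monomial γ 1 ∈ H) := by
  obtain ⟨w, hα⟩ : ∃ w, Finsupp.weight n α = w := ⟨_, rfl⟩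
  -- The ordering is local and not well-founded on all monomials; it is so on the finite set of
  -- those of weight `w`.
  have wf := (finite_weight_eq hpos w).wellFoundedOn (r := negDegRevLexLT)
  refine wf.induction (P := fun α => ∃ γ, (∀ i, ¬ l i ≤ γ) ∧
      Finsupp.weight n γ = Finsupp.weight n α ∧
      (γ = α ∨ negDegRevLexLT γ α) ∧ (α.degree < γ.degree → monomial α 1 ∈ H) ∧
      (α.degree = γ.degree → monomial α 1 - monomial γ 1 ∈ H)) hα ?_
  clear hα α
  intro α hα ih
  by_cases hs : ∃ i, l i ≤ α
  swap
  · exact ⟨α, fun i hi => hs ⟨i, hi⟩, rfl, Or.inl rfl, fun h => absurd h (lt_irrefl _),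
      fun _ => by rw [sub_self]; exact zero_mem _⟩
  obtain ⟨i, hi⟩ := hs
  obtain ⟨δ, rfl⟩ := exists_add_of_le hi
  have hβ : Finsupp.weight n (δ + r i) = Finsupp.weight n (l i + δ) := by
    rw [map_add, map_add, hw, add_comm]
  have hlt' : negDegRevLexLT (δ + r i) (l i + δ) := by
    rw [add_comm (l i)]; exact (hlt i).add_left δ
  obtain ⟨γ, h1, h2, h3, h4, h5⟩ := ih _ (hβ.trans hα) hlt'
  have hγ : negDegRevLexLT γ (l i + δ) := by
    rcases h3 with rfl | h3
    · exact hlt'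
    · exact trans_of negDegRevLexLT h3 hlt'
  have hdβ : (γ = δ + r i ∨ negDegRevLexLT γ (δ + r i)) → (δ + r i).degree ≤ γ.degree := by
    rintro (h | h)
    · rw [h]
    · exact h.degree_le
  have hdβ := hdβ h3
  have hdl := (hlt i).degree_le
  have e1 : (monomial (l i + δ) 1 : MvPolynomial (Fin d) K) = monomial δ 1 * monomial (l i) 1 := by
    rw [monomial_mul, add_comm, one_mul]
  have e2 : (monomial (δ + r i) 1 : MvPolynomial (Fin d) K) = monomial δ 1 * monomial (r i) 1 := by
    rw [monomial_mul, one_mul]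
  have e3 : (l i).degree = (r i).degree →
      (monomial (l i + δ) 1 - monomial (δ + r i) 1 : MvPolynomial (Fin d) K) ∈ H := fun h => by
    rw [e1, e2, ← mul_sub]
    exact H.mul_mem_left _ (hH' i h)
  simp only [map_add] at *
  refine ⟨γ, h1, h2.trans hβ, Or.inr hγ, fun h => ?_, fun h => ?_⟩
  -- If this rule raises the degree, its left side is already in `H`; otherwise the rule is
  -- homogeneous, and the claim passes on from the reduced monomial.
  · rcases hdl.lt_or_eq with hd | hd
    · rw [e1]
      exact H.mul_mem_left _ (hH i hd)
    · have := H.add_mem (e3 hd) (h4 (by omega))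
      simpa using this
  · have := H.add_mem (e3 (by omega)) (h5 (by omega))
    simpa using this

theorem leadingIdeal_eq (hpos : ∀ i, 0 < n i)
    (hw : ∀ i, Finsupp.weight n (l i) = Finsupp.weight n (r i))
    (hlt : ∀ i, negDegRevLexLT (r i) (l i))
    (huniq : ∀ α β, (∀ i, ¬ l i ≤ α) → (∀ i, ¬ l i ≤ β) →
      Finsupp.weight n α = Finsupp.weight n β → α = β)
    {G : Set (MvPolynomial (Fin d) K)} (hG : G ⊆ (toricIdeal K n : Set (MvPolynomial (Fin d) K)))
    (hGl : ∀ i, ∃ g ∈ G, IsLeadingExponent g (l i)) :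
    leadingIdeal G = leadingIdeal (toricIdeal K n : Set (MvPolynomial (Fin d) K)) := by
  refine le_antisymm (Ideal.span_mono ?_) (Ideal.span_le.2 ?_)
  · rintro p ⟨f, hf, h⟩
    exact ⟨f, hG hf, h⟩
  rintro _ ⟨f, hf, α, hα, rfl⟩
  have hs : ∃ i, l i ≤ α := by
    by_contra! hs
    obtain ⟨β, hβ, hne, hwβ⟩ := exists_ne_weight_eq hf hα.1
    obtain ⟨γ, h1, h2, h3, -⟩ := exists_standard (K := K) hpos hw hlt (H := ⊤) (by simp) (by simp) β
    obtain rfl := huniq γ α h1 hs (h2.trans hwβ)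
    have hβγ := hα.2 β hβ hne
    rcases h3 with h3 | h3
    · exact hne h3.symm
    · exact irrefl_of negDegRevLexLT β (trans_of negDegRevLexLT hβγ h3)
  obtain ⟨i, hi⟩ := hs
  obtain ⟨δ, rfl⟩ := exists_add_of_le hi
  obtain ⟨g, hg, hgl⟩ := hGl i
  have e : (monomial (l i + δ) 1 : MvPolynomial (Fin d) K) = monomial δ 1 * monomial (l i) 1 := by
    rw [monomial_mul, add_comm, one_mul]
  rw [SetLike.mem_coe, e]
  exact Ideal.mul_mem_left _ _ (Ideal.subset_span ⟨g, hg, _, hgl, rfl⟩)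

theorem leastFormIdeal_le (hpos : ∀ i, 0 < n i)
    (hw : ∀ i, Finsupp.weight n (l i) = Finsupp.weight n (r i))
    (hlt : ∀ i, negDegRevLexLT (r i) (l i))
    (huniq : ∀ α β, (∀ i, ¬ l i ≤ α) → (∀ i, ¬ l i ≤ β) →
      Finsupp.weight n α = Finsupp.weight n β → α = β)
    {H : Ideal (MvPolynomial (Fin d) K)}
    (hH : ∀ i, (l i).degree < (r i).degree → monomial (l i) 1 ∈ H)
    (hH' : ∀ i, (l i).degree = (r i).degree → monomial (l i) 1 - monomial (r i) 1 ∈ H) :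
    leastFormIdeal (toricIdeal K n) ≤ H := by
  classical
  rw [leastFormIdeal, Ideal.span_le]
  rintro _ ⟨f, hf, rfl⟩
  choose γ h1 h2 h3 h4 h5 using exists_standard hpos hw hlt hH hH'
  have hdeg : ∀ α, α.degree ≤ (γ α).degree := fun α => by
    rcases h3 α with h | h
    · rw [h]
    · exact h.degree_le
  set k := sInf {k : ℕ | homogeneousComponent k f ≠ 0} with hk
  -- The degree `k` part of the normal form of `f` vanishes, so it may be subtracted from `f_*` term
  -- by term. Degrees do not drop under reduction, so each resulting difference is `0`, a monomial
  -- in `H` or a homogeneous binomial in `H`.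
  have h0 := sum_smul_eq_zero hf
    (fun α => if (γ α).degree = k then (monomial (γ α) 1 : MvPolynomial (Fin d) K) else 0)
    (fun α β h => by
      have : γ α = γ β := huniq _ _ (h1 α) (h1 β) (by rw [h2, h2, h])
      simp only [this])
  have hlf : leastForm f = ∑ α ∈ f.support, coeff α f •
      ((if α.degree = k then (monomial α 1 : MvPolynomial (Fin d) K) else 0) -
        if (γ α).degree = k then (monomial (γ α) 1 : MvPolynomial (Fin d) K) else 0) := by
    simp only [smul_sub, Finset.sum_sub_distrib]
    rw [h0, sub_zero, leastForm, ← hk, homogeneousComponent_apply, Finset.sum_filter]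
    refine Finset.sum_congr rfl fun α _ => ?_
    split_ifs <;> simp [smul_monomial]
  rw [SetLike.mem_coe, hlf]
  refine Ideal.sum_mem _ fun α hα => ?_
  rw [smul_eq_C_mul]
  refine Ideal.mul_mem_left _ _ ?_
  have hkα : k ≤ α.degree := sInf_le_degree hα
  have hd := hdeg α
  split_ifs with ha hb hb
  · exact h5 α (by omega)
  · rw [sub_zero]; exact h4 α (by omega)
  · omega
  · rw [sub_zero]; exact zero_mem _

end Reduction

/-- Polynomials that reduce modulo a variable to monomials none of which divides another one do
not generate each other. -/
theorem notMem_span_of_not_le {K : Type*} [Field K] {d m : ℕ} (k : Fin d)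
    {h : Fin m → MvPolynomial (Fin d) K} {l : Fin m → (Fin d →₀ ℕ)}
    (hl : ∀ i, l i ∈ (h i).support) (hl0 : ∀ i, l i k = 0)
    (hs : ∀ i, ∀ α ∈ (h i).support, α = l i ∨ 0 < α k)
    (hle : ∀ i j, j ≠ i → ¬ l j ≤ l i) (i : Fin m) :
    h i ∉ Ideal.span (h '' {j | j ≠ i}) := by
  classical
  intro hi
  -- Adjoining the variable `x_k` encloses the span in a monomial ideal, where membership is tested
  -- by divisibility.
  have key : Ideal.span (h '' {j | j ≠ i}) ≤ Ideal.span ((fun s => monomial s (1 : K)) ''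
      (insert (Finsupp.single k 1) (l '' {j | j ≠ i}))) := by
    rw [Ideal.span_le]
    rintro _ ⟨j, hj, rfl⟩
    refine mem_ideal_span_monomial_image.2 fun α hα => ?_
    rcases hs j α hα with h | h
    · exact ⟨_, Or.inr ⟨j, hj, rfl⟩, h.ge⟩
    · exact ⟨_, Or.inl rfl, Finsupp.single_le_iff.2 h⟩
  obtain ⟨s, hs, hsl⟩ := mem_ideal_span_monomial_image.1 (key hi) _ (hl i)
  rcases hs with rfl | ⟨j, hj, rfl⟩
  · have := Finsupp.single_le_iff.1 hsl
    rw [hl0 i] at this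
    omega
  · exact hle i j hj hsl

/-! ## Cohen-Macaulay tangent cones -/

/-- In a ring whose localization at the prime ideal `m` is Cohen-Macaulay and not
zero-dimensional, an element annihilated by powers of all elements of `m` vanishes locally. -/
theorem exists_mul_eq_zero_of_isLocalCohenMacaulay {A : Type*} [CommRing A] {m p : Ideal A}
    [m.IsPrime] [p.IsPrime] (hA : IsLocalCohenMacaulay (Localization.AtPrime m)) (hpm : p < m)
    {z : A} (hz : ∀ y ∈ m, ∃ N, y ^ N * z = 0) : ∃ s ∉ m, s * z = 0 := by
  obtain ⟨-, rs, hrs, hreg, hdim⟩ := hA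
  cases rs with
  -- An empty regular sequence means dimension zero, so `x ∈ m \ p` would be nilpotent locally,
  -- against `p` being prime and contained in `m`.
  | nil =>
    exfalso
    obtain ⟨x, hxm, hxp⟩ := Set.exists_of_ssubset hpm
    have hd : Ring.KrullDimLE 0 (Localization.AtPrime m) :=
      ringKrullDimZero_iff_ringKrullDim_eq_zero.2 (by simpa using hdim.symm)
    have hx : algebraMap A (Localization.AtPrime m) x ∈
        IsLocalRing.maximalIdeal (Localization.AtPrime m) :=
      (IsLocalization.AtPrime.to_map_mem_maximal_iff _ m x).2 hxm
    obtain ⟨N, hN⟩ := Ring.KrullDimLE.isNilpotent_iff_mem_maximalIdeal.2 hx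
    rw [← map_pow, IsLocalization.map_eq_zero_iff m.primeCompl] at hN
    obtain ⟨s, hs⟩ := hN
    have h0 : (s : A) * x ^ N ∈ p := by rw [hs]; exact p.zero_mem
    rcases Ideal.IsPrime.mem_or_mem ‹p.IsPrime› h0 with h | h
    · exact s.2 (hpm.le h)
    · exact hxp (Ideal.IsPrime.mem_of_pow_mem ‹p.IsPrime› _ h)
  | cons r rs =>
    have hr := ((RingTheory.Sequence.isRegular_cons_iff _ _ _).1 hreg).1
    have hrm := hrs r (by simp)
    -- Up to a unit, the nonzerodivisor `r` is the image of some `y ∈ m`, so a power of `r` kills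
    -- `z`.
    obtain ⟨⟨y, s⟩, hys⟩ := IsLocalization.surj m.primeCompl r
    have hy : y ∈ m := by
      rw [← IsLocalization.AtPrime.to_map_mem_maximal_iff (Localization.AtPrime m) m y, ← hys]
      exact Ideal.mul_mem_right _ _ hrm
    obtain ⟨N, hN⟩ := hz y hy
    have h0 : r ^ N * algebraMap A (Localization.AtPrime m) z = 0 := by
      have h1 : (r * algebraMap A (Localization.AtPrime m) s) ^ N *
          algebraMap A (Localization.AtPrime m) z = 0 := by
        rw [hys, ← map_pow, ← map_mul, hN, map_zero]
      have hu : IsUnit (algebraMap A (Localization.AtPrime m) s ^ N) :=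
        (IsLocalization.map_units (Localization.AtPrime m) s).pow N
      rw [mul_pow, mul_right_comm] at h1
      exact (hu.mul_left_eq_zero).1 h1
    have hz0 : algebraMap A (Localization.AtPrime m) z = 0 := by
      have := hr.pow N
      exact this (by simpa [smul_eq_mul] using h0)
    rw [IsLocalization.map_eq_zero_iff m.primeCompl] at hz0
    obtain ⟨s, hs⟩ := hz0
    exact ⟨s, s.2, hs⟩

section TangentCone

variable {K : Type*} [Field K] {d : ℕ} {n : Fin (d + 1) → ℕ}

/-- The first coordinate, of least weight, is not nilpotent on the tangent cone: the tangent cone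
contains the first coordinate axis. -/
theorem leastFormIdeal_le_ker_axis (hn : ∀ i, i ≠ 0 → n 0 < n i) (hpos : ∀ i, 0 < n i) :
    leastFormIdeal (toricIdeal K n) ≤ RingHom.ker
      (aeval (fun i => if i = 0 then (Polynomial.X : Polynomial K) else 0) :
        MvPolynomial (Fin (d + 1)) K →ₐ[K] Polynomial K) := by
  rw [leastFormIdeal, Ideal.span_le]
  rintro _ ⟨f, hf, rfl⟩
  rw [SetLike.mem_coe, RingHom.mem_ker, (leastForm f).as_sum, map_sum]
  refine Finset.sum_eq_zero fun α hα => ?_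
  -- Since `n 0` is the smallest weight, a pure power of the first variable is the only monomial of
  -- largest degree in its weight class; it cannot occur in a least form.
  obtain ⟨i, hi0, hi⟩ : ∃ i, i ≠ 0 ∧ α i ≠ 0 := by
    by_contra! H
    obtain ⟨β, hβ, hne, hw⟩ := exists_ne_weight_eq hf (support_leastForm_subset f hα)
    have hd : α.degree ≤ β.degree := by
      rw [degree_eq_of_mem_support_leastForm hα]
      exact sInf_le_degree hβ
    rw [Finsupp.weight_apply, Finsupp.weight_apply, Finsupp.sum_fintype _ _ (by simp),
      Finsupp.sum_fintype _ _ (by simp)] at hw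
    rw [Finsupp.degree_eq_sum, Finsupp.degree_eq_sum] at hd
    simp only [smul_eq_mul] at hw
    rw [Fin.sum_univ_succ, Fin.sum_univ_succ (fun i => α i * n i)] at hw
    rw [Fin.sum_univ_succ, Fin.sum_univ_succ (fun i => β i)] at hd
    have e : ∀ j : Fin d, α j.succ = 0 := fun j => H _ (Fin.succ_ne_zero j)
    simp only [e, Finset.sum_const_zero, add_zero, zero_mul] at hw hd
    have hle : ∑ j : Fin d, β j.succ * (n 0 + 1) ≤ ∑ j : Fin d, β j.succ * n j.succ :=
      Finset.sum_le_sum fun j _ => Nat.mul_le_mul_left _ (hn _ (Fin.succ_ne_zero j))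
    rw [← Finset.sum_mul] at hle
    have hz : ∑ j : Fin d, β j.succ = 0 := by
      have := Nat.mul_le_mul_right (n 0) hd
      rw [mul_add, mul_one] at hle
      rw [add_mul] at this
      omega
    have hb : ∀ j : Fin d, β j.succ = 0 := fun j => (Finset.sum_eq_zero_iff.1 hz) j (by simp)
    simp only [hb, zero_mul, Finset.sum_const_zero, add_zero] at hw
    refine hne (Finsupp.ext fun j => ?_)
    refine Fin.cases ?_ (fun j => ?_) j
    · exact Nat.eq_of_mul_eq_mul_right (hpos 0) hw
    · rw [hb, e]
  rw [aeval_monomial, Finsupp.prod,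
    Finset.prod_eq_zero (Finsupp.mem_support_iff.2 hi) (by simp [hi0, hi]), mul_zero]

/-- This is the least form of `X i ^ n 0 - X 0 ^ n i`. All variables but the first are thus
nilpotent on the tangent cone. -/
theorem X_pow_mem_leastFormIdeal (hn : ∀ i, i ≠ 0 → n 0 < n i) {i : Fin (d + 1)} (hi : i ≠ 0) :
    (X i ^ n 0 : MvPolynomial (Fin (d + 1)) K) ∈ leastFormIdeal (toricIdeal K n) := by
  rw [X_pow_eq_monomial]
  refine monomial_mem_leastFormIdeal (β := Finsupp.single 0 (n i))
    (monomial_sub_mem_toricIdeal ?_) ?_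
  · simp [Finsupp.weight_single, mul_comm]
  · simpa using hn i hi

/-- If the tangent cone is Cohen-Macaulay, the first coordinate may be cancelled from monomials
in the ideal of least forms. -/
theorem exists_le_of_monomial_add_mem (hn : ∀ i, i ≠ 0 → n 0 < n i) (hpos : ∀ i, 0 < n i)
    (hCM : HasCohenMacaulayTangentCone K n) {S : Set (Fin (d + 1) →₀ ℕ)}
    (hS : toricIdeal K n ≤ Ideal.span ((fun s => monomial s (1 : K)) '' S))
    {α : Fin (d + 1) →₀ ℕ} {k : ℕ}
    (h : monomial (Finsupp.single 0 k + α) 1 ∈ leastFormIdeal (toricIdeal K n)) :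
    ∃ s ∈ S, s ≤ α := by
  set J := leastFormIdeal (toricIdeal K n) with hJ
  let ev : MvPolynomial (Fin (d + 1)) K →ₐ[K] Polynomial K :=
    aeval (fun i => if i = 0 then Polynomial.X else 0)
  have hev : ∀ a ∈ J, ev a = 0 := leastFormIdeal_le_ker_axis hn hpos
  have hcc : ∀ f : MvPolynomial (Fin (d + 1)) K, (ev f).coeff 0 = constantCoeff f := by
    intro f
    induction f using MvPolynomial.induction_on with
    | C a => simp [ev]
    | add p q hp hq => simp [hp, hq]
    | mul_X p i hp =>
      rw [map_mul, Polynomial.mul_coeff_zero, hp, map_mul]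
      congr 1
      simp only [ev, aeval_X, constantCoeff_X]
      split_ifs <;> simp
  -- The kernels of `φ` and `ψ` are the primes of the first axis and of the origin.
  let φ : MvPolynomial (Fin (d + 1)) K ⧸ J →+* Polynomial K := Ideal.Quotient.lift J ev hev
  let ψ : MvPolynomial (Fin (d + 1)) K ⧸ J →+* K := Polynomial.constantCoeff.comp φ
  have hφ : ∀ f, φ (Ideal.Quotient.mk J f) = ev f := fun f => rfl
  have hψ : ∀ f, ψ (Ideal.Quotient.mk J f) = constantCoeff f := fun f => hcc f
  have hp : (RingHom.ker φ).IsPrime := RingHom.ker_isPrime φ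
  have hm : (RingHom.ker ψ).IsPrime := RingHom.ker_isPrime ψ
  have hpm : RingHom.ker φ < RingHom.ker ψ := by
    refine lt_of_le_of_ne (fun x hx => ?_) fun he => ?_
    · rw [RingHom.mem_ker] at hx ⊢
      simp [ψ, hx]
    · have h1 : Ideal.Quotient.mk J (X 0) ∈ RingHom.ker ψ := by
        rw [RingHom.mem_ker, hψ, constantCoeff_X]
      rw [← he, RingHom.mem_ker, hφ] at h1
      simp [ev] at h1
  have hz : ∀ y ∈ RingHom.ker ψ, ∃ N, y ^ N * Ideal.Quotient.mk J (monomial α 1) = 0 := by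
    -- `Q` is the colon ideal `(J : x^α)`; its radical contains every variable.
    let Q : Ideal (MvPolynomial (Fin (d + 1)) K) :=
      ((Ideal.span {Ideal.Quotient.mk J (monomial α 1)}).annihilator.comap (Ideal.Quotient.mk J))
    have hQ : ∀ y, y ∈ Q ↔ y * monomial α 1 ∈ J := fun y => by
      rw [Ideal.mem_comap, Ideal.span, Submodule.mem_annihilator_span_singleton, smul_eq_mul,
        ← map_mul, Ideal.Quotient.eq_zero_iff_mem]
    have hX : ∀ i, (X i : MvPolynomial (Fin (d + 1)) K) ∈ Q.radical := fun i => by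
      by_cases hi : i = 0
      · refine ⟨k, (hQ _).2 ?_⟩
        rwa [hi, X_pow_eq_monomial, monomial_mul, one_mul]
      · exact ⟨n 0, (hQ _).2 (J.mul_mem_right _ (X_pow_mem_leastFormIdeal hn hi))⟩
    intro y hy
    obtain ⟨y, rfl⟩ := Ideal.Quotient.mk_surjective y
    rw [RingHom.mem_ker, hψ] at hy
    have hyQ : y ∈ Q.radical := by
      have : y ∈ Ideal.span (Set.range (X : Fin (d + 1) → MvPolynomial (Fin (d + 1)) K)) := by
        rw [← Set.image_univ, mem_ideal_span_X_image]
        intro m hm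
        by_contra! H
        refine mem_support_iff.1 hm ?_
        rw [show m = 0 from Finsupp.ext fun i => H i (Set.mem_univ i)]
        exact hy
      refine Ideal.span_le.2 ?_ this
      rintro _ ⟨i, rfl⟩
      exact hX i
    obtain ⟨N, hN⟩ := hyQ
    refine ⟨N, ?_⟩
    rw [← map_pow, ← map_mul, Ideal.Quotient.eq_zero_iff_mem]
    exact (hQ _).1 hN
  obtain ⟨s, hs, hs0⟩ := exists_mul_eq_zero_of_isLocalCohenMacaulay (hCM.2 (RingHom.ker ψ)) hpm hz
  obtain ⟨s, rfl⟩ := Ideal.Quotient.mk_surjective s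
  rw [RingHom.mem_ker, hψ] at hs
  rw [← map_mul, Ideal.Quotient.eq_zero_iff_mem] at hs0
  -- As `s` has nonzero constant term, `x^α` occurs in `s * x^α ∈ J`, and `J` lies in the monomial
  -- ideal generated by `S`.
  refine mem_ideal_span_monomial_image.1 (leastFormIdeal_le_span_monomial hS hs0) α ?_
  have := coeff_mul_monomial 0 α 1 s
  rw [zero_add, mul_one] at this
  rw [mem_support_iff, this]
  exact hs

end TangentCone

/-! ## Monomials in four variables -/

/-- The exponent of `x_1^a x_2^b x_3^c x_4^d`. -/
noncomputable def expo (a b c d : ℕ) : Fin 4 →₀ ℕ := Finsupp.equivFunOnFinite.symm ![a, b, c, d]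

section Expo

variable (a b c d : ℕ)

@[simp] theorem expo_zero : expo a b c d 0 = a := rfl
@[simp] theorem expo_one : expo a b c d 1 = b := rfl
@[simp] theorem expo_two : expo a b c d 2 = c := rfl
@[simp] theorem expo_three : expo a b c d 3 = d := rfl

@[simp] theorem degree_expo : (expo a b c d).degree = a + b + c + d := by
  simp [Finsupp.degree_eq_sum, Fin.sum_univ_four]

@[simp] theorem weight_expo (n : Fin 4 → ℕ) :
    Finsupp.weight n (expo a b c d) = a * n 0 + b * n 1 + c * n 2 + d * n 3 := by
  simp [Finsupp.weight_apply, Finsupp.sum_fintype, Fin.sum_univ_four]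

theorem exponent_le_iff (α β : Fin 4 →₀ ℕ) :
    α ≤ β ↔ α 0 ≤ β 0 ∧ α 1 ≤ β 1 ∧ α 2 ≤ β 2 ∧ α 3 ≤ β 3 := by
  rw [Finsupp.le_def]
  simp [Fin.forall_fin_succ]

theorem exponent_ext_iff (α β : Fin 4 →₀ ℕ) :
    α = β ↔ α 0 = β 0 ∧ α 1 = β 1 ∧ α 2 = β 2 ∧ α 3 = β 3 := by
  rw [Finsupp.ext_iff]
  simp [Fin.forall_fin_succ]

theorem monomial_expo (K : Type*) [Field K] :
    (monomial (expo a b c d) 1 : MvPolynomial (Fin 4) K) =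
      X 0 ^ a * X 1 ^ b * X 2 ^ c * X 3 ^ d := by
  rw [monomial_eq, Finsupp.prod_fintype _ _ (by simp), Fin.prod_univ_four]
  simp

end Expo

theorem negDegRevLexLT_of_degree_eq {α β : Fin 4 →₀ ℕ} (hd : α.degree = β.degree)
    (h : β 0 < α 0) : negDegRevLexLT α β :=
  Or.inr ⟨hd, 0, h, fun j hj => absurd hj (Fin.not_lt_zero j)⟩

/-! ## Case 3(b) -/

section Case

variable {K : Type*} [Field K] {n : Fin 4 → ℕ}
  {a₁ a₂ a₃ a₄ a₁₂ a₁₄ a₂₃ a₂₄ a₃₁ a₃₂ a₄₁ a₄₃ : ℕ}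

/-- The generators in case 3(b), as differences of monomials. -/
theorem IsCase3b.toricIdeal_eq (hC : IsCase3b K n a₁ a₂ a₃ a₄ a₁₂ a₁₄ a₂₃ a₂₄ a₃₁ a₃₂ a₄₁ a₄₃) :
    toricIdeal K n = Ideal.span (Set.range fun i => monomial
        ((![expo a₁ 0 0 0, expo 0 a₂ 0 0, expo 0 0 a₃ 0, expo 0 0 0 a₄,
          expo a₃₁ 0 0 a₂₄] : Fin 5 → (Fin 4 →₀ ℕ)) i) 1 - monomial
        ((![expo 0 a₁₂ 0 a₁₄, expo 0 0 a₂₃ a₂₄, expo a₃₁ a₃₂ 0 0, expo a₄₁ 0 a₄₃ 0,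
          expo 0 a₁₂ a₄₃ 0] : Fin 5 → (Fin 4 →₀ ℕ)) i) 1) := by
  rw [hC.gen.1]
  congr 2
  ext1 i
  fin_cases i <;> simp [monomial_expo]

/-- The weights of the generators in case 3(b). -/
theorem IsCase3b.weight_eq (hC : IsCase3b K n a₁ a₂ a₃ a₄ a₁₂ a₁₄ a₂₃ a₂₄ a₃₁ a₃₂ a₄₁ a₄₃) :
    a₁ * n 0 = a₁₂ * n 1 + a₁₄ * n 3 ∧ a₂ * n 1 = a₂₃ * n 2 + a₂₄ * n 3 ∧
    a₃ * n 2 = a₃₁ * n 0 + a₃₂ * n 1 ∧ a₄ * n 3 = a₄₁ * n 0 + a₄₃ * n 2 ∧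
    a₃₁ * n 0 + a₂₄ * n 3 = a₁₂ * n 1 + a₄₃ * n 2 := by
  have h := fun i => weight_eq_of_mem_toricIdeal (K := K) (n := n)
    (hC.toricIdeal_eq.ge (Ideal.subset_span (Set.mem_range_self i)))
  simpa [Fin.forall_fin_succ] using h

/-- A monomial sharing its weight with another one is divisible by a monomial of a generator. -/
theorem IsCase3b.exists_le (hC : IsCase3b K n a₁ a₂ a₃ a₄ a₁₂ a₁₄ a₂₃ a₂₄ a₃₁ a₃₂ a₄₁ a₄₃)
    {α β : Fin 4 →₀ ℕ} (h : Finsupp.weight n α = Finsupp.weight n β) (hne : α ≠ β) :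
    ∃ s ∈ Set.range ![expo a₁ 0 0 0, expo 0 a₂ 0 0, expo 0 0 a₃ 0, expo 0 0 0 a₄,
          expo a₃₁ 0 0 a₂₄] ∪ Set.range ![expo 0 a₁₂ 0 a₁₄, expo 0 0 a₂₃ a₂₄, expo a₃₁ a₃₂ 0 0,
          expo a₄₁ 0 a₄₃ 0, expo 0 a₁₂ a₄₃ 0], s ≤ α := by
  classical
  refine mem_ideal_span_monomial_image.1 (toricIdeal_le_span_monomial hC.toricIdeal_eq
    (monomial_sub_mem_toricIdeal (K := K) h)) α ?_
  simp [mem_support_iff, coeff_monomial, hne.symm]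

/-- The exponents `a₁`, `a₂` are the least for which a pure power of `x_1`, `x_2` shares its weight
with another monomial. Combining the weights of `f_3`, `f_5`, `f_2` (resp. `f_4`, `f_5`, `f_1`)
leaves a relation between powers of two variables, with exponent of `x_2` (resp. `x_1`) below that
bound, so it is trivial. -/
theorem IsCase3b.exponent_eq (hC : IsCase3b K n a₁ a₂ a₃ a₄ a₁₂ a₁₄ a₂₃ a₂₄ a₃₁ a₃₂ a₄₁ a₄₃)
    (hpos : ∀ i, 0 < n i) : a₃ = a₂₃ + a₄₃ ∧ a₄ = a₁₄ + a₂₄ := by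
  obtain ⟨w1, w2, w3, w4, w5⟩ := hC.weight_eq
  have p1 : ∀ c β, Finsupp.weight n (expo c 0 0 0) = Finsupp.weight n β → expo c 0 0 0 ≠ β →
      a₁ ≤ c := fun c β h hne => by
    have := hC.exists_le h hne
    have := hC.h12; have := hC.h14; have := hC.h23; have := hC.h24; have := hC.h31
    have := hC.h32; have := hC.h41; have := hC.h43
    simp [or_and_right, exists_or, exponent_le_iff] at *
    omega
  have p2 : ∀ c β, Finsupp.weight n (expo 0 c 0 0) = Finsupp.weight n β → expo 0 c 0 0 ≠ β →
      a₂ ≤ c := fun c β h hne => by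
    have := hC.exists_le h hne
    have := hC.h12; have := hC.h14; have := hC.h23; have := hC.h24; have := hC.h31
    have := hC.h32; have := hC.h41; have := hC.h43
    simp [or_and_right, exists_or, exponent_le_iff] at *
    omega
  obtain ⟨h12, h14, h23, h24, h31, h32, h41, h43, -⟩ := hC
  have q0 := hpos 0
  have q1 := hpos 1
  have q2 := hpos 2
  have q3 := hpos 3
  constructor
  · obtain ⟨e, rfl⟩ := Nat.exists_eq_add_of_lt h43.2
    have hw : (a₃₂ + a₁₂) * n 1 = (e + 1) * n 2 + a₂₄ * n 3 := by linarith
    obtain ⟨c, hc⟩ := Nat.exists_eq_add_of_le (p2 (a₃₂ + a₁₂) (expo 0 0 (e + 1) a₂₄)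
      (by simpa using hw) (by rw [Ne, exponent_ext_iff]; simp))
    have hw' : c * n 1 + a₂₃ * n 2 = (e + 1) * n 2 := by
      rw [hc] at hw; linarith
    obtain ⟨k, hk⟩ : ∃ k, e + 1 = a₂₃ + k :=
      Nat.exists_eq_add_of_le (Nat.le_of_mul_le_mul_right (by omega) q2)
    have hw2 : c * n 1 = k * n 2 := by rw [hk] at hw'; linarith
    have hc0 : c = 0 := by
      by_contra h0
      have := p2 c (expo 0 0 k 0) (by simpa using hw2)
        (by rw [Ne, exponent_ext_iff]; simp [h0])
      omega
    rw [hc0, zero_mul, eq_comm, mul_eq_zero] at hw2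
    omega
  · obtain ⟨e, rfl⟩ := Nat.exists_eq_add_of_lt h24.2
    have hw : (a₃₁ + a₄₁) * n 0 = a₁₂ * n 1 + (e + 1) * n 3 := by linarith
    obtain ⟨c, hc⟩ := Nat.exists_eq_add_of_le (p1 (a₃₁ + a₄₁) (expo 0 a₁₂ 0 (e + 1))
      (by simpa using hw) (by rw [Ne, exponent_ext_iff]; simp))
    have hw' : c * n 0 + a₁₄ * n 3 = (e + 1) * n 3 := by
      rw [hc] at hw; linarith
    obtain ⟨k, hk⟩ : ∃ k, e + 1 = a₁₄ + k :=
      Nat.exists_eq_add_of_le (Nat.le_of_mul_le_mul_right (by omega) q3)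
    have hw2 : c * n 0 = k * n 3 := by rw [hk] at hw'; linarith
    have hc0 : c = 0 := by
      by_contra h0
      have := p1 c (expo 0 0 0 k) (by simpa using hw2)
        (by rw [Ne, exponent_ext_iff]; simp [h0])
      omega
    rw [hc0, zero_mul, eq_comm, mul_eq_zero] at hw2
    omega

/-- The monomials divisible by none of the leading monomials have pairwise different weights. -/
theorem IsCase3b.standard_unique
    (hC : IsCase3b K n a₁ a₂ a₃ a₄ a₁₂ a₁₄ a₂₃ a₂₄ a₃₁ a₃₂ a₄₁ a₄₃)
    (hpos : ∀ i, 0 < n i) (hle : a₄₃ ≤ a₂₃) {α β : Fin 4 →₀ ℕ}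
    (hα : ∀ i, ¬ (![expo 0 a₁₂ 0 a₁₄, expo 0 0 a₂₃ a₂₄, expo 0 0 a₃ 0, expo 0 0 0 a₄,
      expo 0 a₁₂ a₄₃ 0, expo 0 (a₂ + a₁₂) 0 0] : Fin 6 → (Fin 4 →₀ ℕ)) i ≤ α)
    (hβ : ∀ i, ¬ (![expo 0 a₁₂ 0 a₁₄, expo 0 0 a₂₃ a₂₄, expo 0 0 a₃ 0, expo 0 0 0 a₄,
      expo 0 a₁₂ a₄₃ 0, expo 0 (a₂ + a₁₂) 0 0] : Fin 6 → (Fin 4 →₀ ℕ)) i ≤ β)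
    (h : Finsupp.weight n α = Finsupp.weight n β) : α = β := by
  -- `M` collects monomials that vanish modulo `(I(C), x_1)`. On the others `φ` applies `x_3^a₂₃
  -- x_4^a₂₄ → x_2^a₂` once; a second application is impossible because `a₃ ≤ 2 a₂₃`.
  let M : (Fin 4 →₀ ℕ) → Prop := fun α => 0 < α 0 ∨ (a₁₂ ≤ α 1 ∧ a₁₄ ≤ α 3) ∨ a₃ ≤ α 2 ∨
    a₄ ≤ α 3 ∨ (a₁₂ ≤ α 1 ∧ a₄₃ ≤ α 2) ∨ a₂ + a₁₂ ≤ α 1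
  let φ : (Fin 4 →₀ ℕ) → Option (ℕ × ℕ × ℕ) := fun α =>
    if M α then none
    else if a₂₃ ≤ α 2 ∧ a₂₄ ≤ α 3 then some (α 1 + a₂, α 2 - a₂₃, α 3 - a₂₄)
    else some (α 1, α 2, α 3)
  have hφ : ∀ α β, Finsupp.weight n α = Finsupp.weight n β → φ α = φ β := by
    obtain ⟨e3, e4⟩ := hC.exponent_eq hpos
    intro α β
    refine eq_of_weight_eq hC.toricIdeal_eq φ ?_
    obtain ⟨h12, h14, h23, h24, h31, h32, h41, h43, -⟩ := hC
    have zero : ∀ i (u v : Fin 4 →₀ ℕ), M (i + u) → M (i + v) → φ (i + u) = φ (i + v) :=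
      fun i u v hu hv => by simp only [φ, if_pos hu, if_pos hv]
    intro i m
    fin_cases i
    · exact zero _ _ _ (by simp [M]; omega) (by simp [M])
    -- Only `f_2` has sides that may survive. Under `hM` both vanish: on the right, `x_2^a₁₂` meets
    -- `x_3^a₂₃` with `a₄₃ ≤ a₂₃`, while `x_4^a₁₄` and `x_3^a₄₃` complete `x_4^a₄` and `x_3^a₃`.
    · by_cases hM : a₁₂ ≤ m 1 ∨ a₁₄ ≤ m 3 ∨ a₄₃ ≤ m 2 ∨ 0 < m 0
      · exact zero _ _ _ (by simp [M]; omega) (by simp [M]; omega)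
      · have hu : ¬ M (m + expo 0 a₂ 0 0) := by simp [M]; omega
        have hv : ¬ M (m + expo 0 0 a₂₃ a₂₄) := by simp [M]; omega
        have hu' : ¬ (a₂₃ ≤ m 2 ∧ a₂₄ ≤ m 3) := by omega
        simp [φ, if_neg hu, if_neg hv, hu']
    · exact zero _ _ _ (by simp [M]) (by simp [M]; omega)
    · exact zero _ _ _ (by simp [M]) (by simp [M]; omega)
    · exact zero _ _ _ (by simp [M]; omega) (by simp [M])
  let P : ℕ → ℕ → ℕ → Prop := fun b c d => ¬ (a₁₂ ≤ b ∧ a₁₄ ≤ d) ∧ ¬ (a₂₃ ≤ c ∧ a₂₄ ≤ d) ∧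
    c < a₃ ∧ d < a₄ ∧ ¬ (a₁₂ ≤ b ∧ a₄₃ ≤ c) ∧ b < a₂ + a₁₂
  have hP : ∀ a b c d, (∀ i, ¬ (![expo 0 a₁₂ 0 a₁₄, expo 0 0 a₂₃ a₂₄, expo 0 0 a₃ 0, expo 0 0 0 a₄,
      expo 0 a₁₂ a₄₃ 0, expo 0 (a₂ + a₁₂) 0 0] : Fin 6 → (Fin 4 →₀ ℕ)) i ≤ expo a b c d) →
      P b c d := by
    intro a b c d h
    simpa [Fin.forall_fin_succ, exponent_le_iff, P] using h
  have hφ' : ∀ a b c d, ¬ M (expo a b c d) → ¬ (a₂₃ ≤ c ∧ a₂₄ ≤ d) →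
      φ (expo a b c d) = some (b, c, d) := fun a b c d h h' => by
    simp only [φ, if_neg h]
    exact if_neg h'
  -- This is the situation after cancelling the common power of `x_1`: `φ` fixes the side without
  -- `x_1`, and would be `none` on the other if `k > 0`.
  have core : ∀ k b c d b' c' d', P b c d → P b' c' d' →
      Finsupp.weight n (expo 0 b c d) = Finsupp.weight n (expo k b' c' d') →
      k = 0 ∧ b = b' ∧ c = c' ∧ d = d' := by
    intro k b c d b' c' d' h1 h2 hw
    have hM : ¬ M (expo 0 b c d) := by simp [M, P] at h1 ⊢; omega
    have := hφ _ _ hw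
    rw [hφ' _ _ _ _ hM h1.2.1] at this
    by_cases hk : k = 0
    · have hM' : ¬ M (expo k b' c' d') := by simp [M, P, hk] at h2 ⊢; omega
      rw [hφ' _ _ _ _ hM' h2.2.1] at this
      simpa [hk] using this
    · have hM' : M (expo k b' c' d') := by simp [M]; omega
      simp only [φ, if_pos hM'] at this
      exact absurd this (by simp)
  have he : ∀ α : Fin 4 →₀ ℕ, ∃ a b c d, α = expo a b c d := fun α =>
    ⟨α 0, α 1, α 2, α 3, by simp [exponent_ext_iff]⟩
  obtain ⟨a, b, c, d, rfl⟩ := he α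
  obtain ⟨a', b', c', d', rfl⟩ := he β
  have h1 := hP _ _ _ _ hα
  have h2 := hP _ _ _ _ hβ
  rw [weight_expo, weight_expo] at h
  rw [exponent_ext_iff]
  simp only [expo_zero, expo_one, expo_two, expo_three]
  rcases le_total a a' with hle | hle
  · obtain ⟨k, rfl⟩ := Nat.exists_eq_add_of_le hle
    have := core k b c d b' c' d' h1 h2 (by rw [weight_expo, weight_expo]; linarith)
    omega
  · obtain ⟨k, rfl⟩ := Nat.exists_eq_add_of_le hle
    have := core k b' c' d' b c d h2 h1 (by rw [weight_expo, weight_expo]; linarith)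
    omega

end Case

/-! ### Degree inequalities, standard basis and tangent cone -/

section Case

variable {K : Type*} [Field K] {n : Fin 4 → ℕ}
  {a₁ a₂ a₃ a₄ a₁₂ a₁₄ a₂₃ a₂₄ a₃₁ a₃₂ a₄₁ a₄₃ : ℕ}

/-- A monomial without `x_1` that becomes the least form of an element of the toric ideal after
multiplication by a power of `x_1` is divisible by a monomial of a generator. -/
theorem IsCase3b.exists_le_of_degree_lt
    (hC : IsCase3b K n a₁ a₂ a₃ a₄ a₁₂ a₁₄ a₂₃ a₂₄ a₃₁ a₃₂ a₄₁ a₄₃) (hpos : ∀ i, 0 < n i)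
    (hmono : StrictMono n) (hCM : HasCohenMacaulayTangentCone K n) {k c d : ℕ} {β : Fin 4 →₀ ℕ}
    (hw : Finsupp.weight n (expo k 0 c d) = Finsupp.weight n β)
    (hd : (expo k 0 c d).degree < β.degree) :
    (a₂₃ ≤ c ∧ a₂₄ ≤ d) ∨ a₃ ≤ c ∨ a₄ ≤ d := by
  have h := monomial_mem_leastFormIdeal (monomial_sub_mem_toricIdeal (K := K) hw) hd
  have e : expo k 0 c d = Finsupp.single 0 k + expo 0 0 c d := by
    rw [exponent_ext_iff]
    simp
  rw [e] at h
  have hs := exists_le_of_monomial_add_mem (fun i hi => hmono (Fin.pos_of_ne_zero hi)) hpos hCM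
    (toricIdeal_le_span_monomial hC.toricIdeal_eq) h
  obtain ⟨h12, h14, h23, h24, h31, h32, h41, h43, -⟩ := hC
  simp [or_and_right, exists_or, exponent_le_iff] at hs
  omega

theorem add_lt_of_weight_eq {a b c p q r : ℕ} (hpq : p < q) (hpr : p < r) (hb : 0 < b)
    (h : a * p = b * q + c * r) : b + c < a := by
  have h1 : b * p < b * q := Nat.mul_lt_mul_of_pos_left hpq hb
  have h2 : c * p ≤ c * r := Nat.mul_le_mul_left _ hpr.le
  have h3 : (b + c) * p < a * p := by rw [add_mul, h]; omega
  exact lt_of_mul_lt_mul_right h3 (Nat.zero_le _)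

theorem lt_add_of_weight_eq {a b c p q r : ℕ} (hpq : p < r) (hpr : q ≤ r) (hb : 0 < b)
    (h : a * r = b * p + c * q) : a < b + c := by
  have h1 : b * p < b * r := Nat.mul_lt_mul_of_pos_left hpq hb
  have h2 : c * q ≤ c * r := Nat.mul_le_mul_left _ hpr
  have h3 : a * r < (b + c) * r := by rw [add_mul, h]; omega
  exact lt_of_mul_lt_mul_right h3 (Nat.zero_le _)

/-- The standard basis and the tangent cone in case 3(b), for a sixth element
`x_2^(a_2 + a_12) - x_1^r₀ x_3^r₂ x_4^r₃` whose second monomial has an `x_1`-free part divisible by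
no monomial of a generator. -/
theorem IsCase3b.standardBasis_and_tangentCone
    (hC : IsCase3b K n a₁ a₂ a₃ a₄ a₁₂ a₁₄ a₂₃ a₂₄ a₃₁ a₃₂ a₄₁ a₄₃) (hpos : ∀ i, 0 < n i)
    (hmono : StrictMono n) (hCM : HasCohenMacaulayTangentCone K n) (hle : a₄₃ ≤ a₂₃)
    {r₀ r₂ r₃ : ℕ} (hr₀ : 0 < r₀) (hr₂ : r₂ < a₃) (hr₃ : r₃ < a₄) (hr : r₂ < a₂₃ ∨ r₃ < a₂₄)
    (hw : (a₂ + a₁₂) * n 1 = r₀ * n 0 + r₂ * n 2 + r₃ * n 3) :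
    IsStandardBasis
        {X 0 ^ a₁ - X 1 ^ a₁₂ * X 3 ^ a₁₄,
          X 1 ^ a₂ - X 2 ^ a₂₃ * X 3 ^ a₂₄,
          X 2 ^ a₃ - X 0 ^ a₃₁ * X 1 ^ a₃₂,
          X 3 ^ a₄ - X 0 ^ a₄₁ * X 2 ^ a₄₃,
          X 0 ^ a₃₁ * X 3 ^ a₂₄ - X 1 ^ a₁₂ * X 2 ^ a₄₃,
          X 1 ^ (a₂ + a₁₂) - X 0 ^ r₀ * X 2 ^ r₂ * X 3 ^ r₃}
        (toricIdeal K n) ∧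
      ∀ g₅ g₆ : MvPolynomial (Fin 4) K,
        ((a₂ + a₁₂ < r₀ + r₂ + r₃ ∧ g₆ = X 1 ^ (a₂ + a₁₂)) ∨
          (a₂ + a₁₂ = r₀ + r₂ + r₃ ∧
            g₆ = X 1 ^ (a₂ + a₁₂) - X 0 ^ r₀ * X 2 ^ r₂ * X 3 ^ r₃)) →
        ((a₁₂ + a₄₃ < a₃₁ + a₂₄ ∧ g₅ = X 1 ^ a₁₂ * X 2 ^ a₄₃) ∨
          (a₁₂ + a₄₃ = a₃₁ + a₂₄ ∧
            g₅ = X 0 ^ a₃₁ * X 3 ^ a₂₄ - X 1 ^ a₁₂ * X 2 ^ a₄₃)) →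
        IsMinimallyGeneratedBy (leastFormIdeal (toricIdeal K n))
          ![X 1 ^ a₁₂ * X 3 ^ a₁₄, X 2 ^ a₂₃ * X 3 ^ a₂₄, X 2 ^ a₃, X 3 ^ a₄, g₅, g₆] := by
  classical
  obtain ⟨w1, w2, w3, w4, w5⟩ := hC.weight_eq
  have h01 : n 0 < n 1 := hmono (by decide)
  have h12' : n 1 < n 2 := hmono (by decide)
  have h23' : n 2 < n 3 := hmono (by decide)
  have huniq := fun α β hα hβ => hC.standard_unique hpos hle (α := α) (β := β) hα hβ
  have d5 : a₁₂ + a₄₃ ≤ a₃₁ + a₂₄ := by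
    by_contra! hd
    have := hC.exists_le_of_degree_lt hpos hmono hCM (k := a₃₁) (c := 0) (d := a₂₄)
      (β := expo 0 a₁₂ a₄₃ 0) (by simpa using w5) (by simpa using hd)
    have := hC.h24; have := hC.h23
    omega
  have d6 : a₂ + a₁₂ ≤ r₀ + r₂ + r₃ := by
    by_contra! hd
    have := hC.exists_le_of_degree_lt hpos hmono hCM (k := r₀) (c := r₂) (d := r₃)
      (β := expo 0 (a₂ + a₁₂) 0 0) (by simpa using hw.symm) (by simpa using hd)
    omega
  obtain ⟨h12, h14, h23, h24, h31, h32, h41, h43, -⟩ := hC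
  have d1 : a₁₂ + a₁₄ < a₁ := add_lt_of_weight_eq h01 (by omega) h12.1 w1
  have d2 : a₂₃ + a₂₄ < a₂ := add_lt_of_weight_eq h12' (by omega) h23.1 w2
  have d3 : a₃ < a₃₁ + a₃₂ := lt_add_of_weight_eq (by omega) (by omega) h31.1 w3
  have d4 : a₄ < a₄₁ + a₄₃ := lt_add_of_weight_eq (by omega) (by omega) h41.1 w4
  set l : Fin 6 → (Fin 4 →₀ ℕ) := ![expo 0 a₁₂ 0 a₁₄, expo 0 0 a₂₃ a₂₄, expo 0 0 a₃ 0,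
    expo 0 0 0 a₄, expo 0 a₁₂ a₄₃ 0, expo 0 (a₂ + a₁₂) 0 0] with hl
  let r : Fin 6 → (Fin 4 →₀ ℕ) := ![expo a₁ 0 0 0, expo 0 a₂ 0 0, expo a₃₁ a₃₂ 0 0,
    expo a₄₁ 0 a₄₃ 0, expo a₃₁ 0 0 a₂₄, expo r₀ 0 r₂ r₃]
  have hwt : ∀ i, Finsupp.weight n (l i) = Finsupp.weight n (r i) := by
    simp [Fin.forall_fin_succ, hl, r, w1, w2, w3, w4, w5, hw]
  have hlt : ∀ i, negDegRevLexLT (r i) (l i) := by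
    -- In equal degree the monomial containing `x_1` is the smaller one.
    have tie : ∀ i, (l i).degree ≤ (r i).degree → l i 0 < r i 0 → negDegRevLexLT (r i) (l i) :=
      fun i h h' => h.lt_or_eq.elim Or.inl fun h => negDegRevLexLT_of_degree_eq h.symm h'
    intro i
    fin_cases i
    · exact Or.inl (by simpa [hl, r] using d1)
    · exact Or.inl (by simpa [hl, r] using d2)
    · exact Or.inl (by simpa [hl, r] using d3)
    · exact Or.inl (by simpa [hl, r] using d4)
    · exact tie 4 (by simpa [hl, r] using d5) h31.1
    · exact tie 5 (by simpa [hl, r] using d6) hr₀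
  have hmem : ∀ i, (monomial (l i) 1 - monomial (r i) 1 : MvPolynomial (Fin 4) K) ∈
    toricIdeal K n := fun i => monomial_sub_mem_toricIdeal (hwt i)
  constructor
  -- The signs account for `f_1`, `f_2`, `f_5`, whose leading monomial is the subtracted one.
  · let G : Fin 6 → MvPolynomial (Fin 4) K := ![
      -(monomial (l 0) 1 - monomial (r 0) 1), -(monomial (l 1) 1 - monomial (r 1) 1),
      monomial (l 2) 1 - monomial (r 2) 1, monomial (l 3) 1 - monomial (r 3) 1,
      -(monomial (l 4) 1 - monomial (r 4) 1), monomial (l 5) 1 - monomial (r 5) 1]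
    have hGI : ∀ i, G i ∈ toricIdeal K n := by
      intro i
      fin_cases i
      exacts [neg_mem (hmem 0), neg_mem (hmem 1), hmem 2, hmem 3, neg_mem (hmem 4), hmem 5]
    have hGl : ∀ i, IsLeadingExponent (G i) (l i) := by
      have hs := fun i => isLeadingExponent_sub (K := K) (hlt i)
      intro i
      fin_cases i
      exacts [(hs 0).neg, (hs 1).neg, hs 2, hs 3, (hs 4).neg, hs 5]
    have hrange : Set.range G ⊆ (toricIdeal K n : Set (MvPolynomial (Fin 4) K)) := by
      rintro _ ⟨i, rfl⟩
      exact hGI i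
    have hst : IsStandardBasis (Set.range G) (toricIdeal K n) :=
      ⟨Set.finite_range G, hrange, leadingIdeal_eq hpos hwt hlt huniq hrange
        fun i => ⟨G i, ⟨i, rfl⟩, hGl i⟩⟩
    convert hst using 1
    simp only [G, hl, r, Matrix.range_cons, Matrix.range_empty, Set.union_empty,
      Set.singleton_union]
    simp [monomial_expo]
  · intro g₅ g₆ hg₆ hg₅
    set h : Fin 6 → MvPolynomial (Fin 4) K := ![X 1 ^ a₁₂ * X 3 ^ a₁₄, X 2 ^ a₂₃ * X 3 ^ a₂₄,
      X 2 ^ a₃, X 3 ^ a₄, g₅, g₆] with hh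
    have e0 : h 0 = monomial (l 0) 1 := by simp [hh, hl, monomial_expo]
    have e1 : h 1 = monomial (l 1) 1 := by simp [hh, hl, monomial_expo]
    have e2 : h 2 = monomial (l 2) 1 := by simp [hh, hl, monomial_expo]
    have e3 : h 3 = monomial (l 3) 1 := by simp [hh, hl, monomial_expo]
    have e4 : ((l 4).degree < (r 4).degree ∧ h 4 = monomial (l 4) 1) ∨
        ((l 4).degree = (r 4).degree ∧ h 4 = -(monomial (l 4) 1 - monomial (r 4) 1)) := by
      simpa [hh, hl, r, monomial_expo] using hg₅
    have e5 : ((l 5).degree < (r 5).degree ∧ h 5 = monomial (l 5) 1) ∨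
        ((l 5).degree = (r 5).degree ∧ h 5 = monomial (l 5) 1 - monomial (r 5) 1) := by
      simpa [hh, hl, r, monomial_expo] using hg₆
    have hform : ∀ i, ((l i).degree < (r i).degree ∧ h i = monomial (l i) 1) ∨
        ((l i).degree = (r i).degree ∧ 0 < r i 0 ∧ (h i = monomial (l i) 1 - monomial (r i) 1 ∨
          h i = -(monomial (l i) 1 - monomial (r i) 1))) := by
      intro i
      fin_cases i
      · exact Or.inl ⟨by simpa [hl, r] using d1, e0⟩
      · exact Or.inl ⟨by simpa [hl, r] using d2, e1⟩
      · exact Or.inl ⟨by simpa [hl, r] using d3, e2⟩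
      · exact Or.inl ⟨by simpa [hl, r] using d4, e3⟩
      · exact e4.imp_right fun e => ⟨e.1, h31.1, Or.inr e.2⟩
      · exact e5.imp_right fun e => ⟨e.1, hr₀, Or.inl e.2⟩
    have hin : ∀ i, h i ∈ Ideal.span (Set.range h) := fun i => Ideal.subset_span ⟨i, rfl⟩
    have hl0 : ∀ i, l i 0 = 0 := by simp [Fin.forall_fin_succ, hl]
    refine ⟨le_antisymm (leastFormIdeal_le hpos hwt hlt huniq ?_ ?_) (Ideal.span_le.2 ?_),
      notMem_span_of_not_le 0 (l := l) ?_ hl0 ?_ ?_⟩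
    · intro i hi
      rcases hform i with e | e
      · exact e.2 ▸ hin i
      · omega
    · intro i hi
      rcases hform i with e | ⟨-, -, e | e⟩
      · omega
      · exact e ▸ hin i
      · exact neg_mem_iff.1 (e ▸ hin i)
    · rintro _ ⟨i, rfl⟩
      rw [SetLike.mem_coe]
      rcases hform i with e | ⟨hd, -, e | e⟩
      · rw [e.2]; exact monomial_mem_leastFormIdeal (hmem i) e.1
      · rw [e]; exact monomial_sub_mem_leastFormIdeal (hmem i) hd
      · rw [e]; exact neg_mem (monomial_sub_mem_leastFormIdeal (hmem i) hd)
    · intro i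
      have hs := (isLeadingExponent_sub (K := K) (hlt i)).1
      rcases hform i with e | ⟨-, -, e | e⟩
      · simp [e.2, mem_support_iff]
      · rwa [e]
      · rwa [e, support_neg]
    · intro i α hα
      have key : ∀ g : MvPolynomial (Fin 4) K, g = monomial (l i) 1 - monomial (r i) 1 →
          0 < r i 0 → α ∈ g.support → α = l i ∨ 0 < α 0 := by
        rintro g rfl hri hα
        rcases Finset.mem_union.1 (support_sub _ _ _ hα) with h | h
        · exact Or.inl (Finset.mem_singleton.1 (support_monomial_subset h))
        · rw [Finset.mem_singleton.1 (support_monomial_subset h)]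
          exact Or.inr hri
      rcases hform i with e | ⟨-, hri, e | e⟩
      · rw [e.2] at hα
        exact Or.inl (Finset.mem_singleton.1 (support_monomial_subset hα))
      · exact key _ e hri hα
      · rw [e, support_neg] at hα
        exact key _ rfl hri hα
    · intro i j hij
      fin_cases i <;> fin_cases j <;> simp [hl, exponent_le_iff] at hij ⊢ <;> omega

end Case

theorem theorem2p25 (K : Type*) [Field K]
    (x₁ x₂ x₃ x₄ : MvPolynomial (Fin 4) K)
    (hx₁ : x₁ = X 0) (hx₂ : x₂ = X 1) (hx₃ : x₃ = X 2) (hx₄ : x₄ = X 3)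
    (n : Fin 4 → ℕ) (hpos : ∀ i, 0 < n i) (hmono : StrictMono n) (hgcd : Finset.univ.gcd n = 1)
    (hCM : HasCohenMacaulayTangentCone K n)
    (a₁ a₂ a₃ a₄ a₁₂ a₁₄ a₂₃ a₂₄ a₃₁ a₃₂ a₄₁ a₄₃ : ℕ)
    (hC : IsCase3b K n a₁ a₂ a₃ a₄ a₁₂ a₁₄ a₂₃ a₂₄ a₃₁ a₃₂ a₄₁ a₄₃)
    (h43 : a₄₃ ≤ a₂₃) :
    -- first subcase
    (a₂₄ < a₁₄ →
      IsStandardBasis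
        {x₁ ^ a₁ - x₂ ^ a₁₂ * x₄ ^ a₁₄,
          x₂ ^ a₂ - x₃ ^ a₂₃ * x₄ ^ a₂₄,
          x₃ ^ a₃ - x₁ ^ a₃₁ * x₂ ^ a₃₂,
          x₄ ^ a₄ - x₁ ^ a₄₁ * x₃ ^ a₄₃,
          x₁ ^ a₃₁ * x₄ ^ a₂₄ - x₂ ^ a₁₂ * x₃ ^ a₄₃,
          x₂ ^ (a₂ + a₁₂) - x₁ ^ a₃₁ * x₃ ^ (a₂₃ - a₄₃) * x₄ ^ (2 * a₂₄)}
        (toricIdeal K n) ∧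
      -- the eight cases: `<` or `=` in each of three comparisons, where the second comparison
      -- determines the generator `g₆` and the third one the generator `g₅`
      ∀ g₅ g₆ : MvPolynomial (Fin 4) K,
        (a₃ < a₃₁ + a₃₂ ∨ a₃ = a₃₁ + a₃₂) →
        ((a₂ + a₁₂ < a₃₁ + a₂₃ - a₄₃ + 2 * a₂₄ ∧
            g₆ = x₂ ^ (a₂ + a₁₂)) ∨
          (a₂ + a₁₂ = a₃₁ + a₂₃ - a₄₃ + 2 * a₂₄ ∧
            g₆ = x₂ ^ (a₂ + a₁₂) - x₁ ^ a₃₁ * x₃ ^ (a₂₃ - a₄₃) * x₄ ^ (2 * a₂₄))) →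
        ((a₁₂ + a₄₃ < a₃₁ + a₂₄ ∧
            g₅ = x₂ ^ a₁₂ * x₃ ^ a₄₃) ∨
          (a₁₂ + a₄₃ = a₃₁ + a₂₄ ∧
            g₅ = x₁ ^ a₃₁ * x₄ ^ a₂₄ - x₂ ^ a₁₂ * x₃ ^ a₄₃)) →
        IsMinimallyGeneratedBy (leastFormIdeal (toricIdeal K n))
          ![x₂ ^ a₁₂ * x₄ ^ a₁₄, x₃ ^ a₂₃ * x₄ ^ a₂₄, x₃ ^ a₃, x₄ ^ a₄, g₅, g₆]) ∧
    -- second subcase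
    (a₁₄ ≤ a₂₄ →
      IsStandardBasis
        {x₁ ^ a₁ - x₂ ^ a₁₂ * x₄ ^ a₁₄,
          x₂ ^ a₂ - x₃ ^ a₂₃ * x₄ ^ a₂₄,
          x₃ ^ a₃ - x₁ ^ a₃₁ * x₂ ^ a₃₂,
          x₄ ^ a₄ - x₁ ^ a₄₁ * x₃ ^ a₄₃,
          x₁ ^ a₃₁ * x₄ ^ a₂₄ - x₂ ^ a₁₂ * x₃ ^ a₄₃,
          x₂ ^ (a₂ + a₁₂) - x₁ ^ a₁ * x₃ ^ a₂₃ * x₄ ^ (a₂₄ - a₁₄)}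
        (toricIdeal K n) ∧
      -- the eight cases: `<` or `=` in each of three comparisons, where the second comparison
      -- determines the generator `g₆` and the third one the generator `g₅`
      ∀ g₅ g₆ : MvPolynomial (Fin 4) K,
        (a₃ < a₃₁ + a₃₂ ∨ a₃ = a₃₁ + a₃₂) →
        ((a₂ + a₁₂ < a₁ + a₂₃ + a₂₄ - a₁₄ ∧
            g₆ = x₂ ^ (a₂ + a₁₂)) ∨
          (a₂ + a₁₂ = a₁ + a₂₃ + a₂₄ - a₁₄ ∧
            g₆ = x₂ ^ (a₂ + a₁₂) - x₁ ^ a₁ * x₃ ^ a₂₃ * x₄ ^ (a₂₄ - a₁₄))) →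
        ((a₁₂ + a₄₃ < a₃₁ + a₂₄ ∧
            g₅ = x₂ ^ a₁₂ * x₃ ^ a₄₃) ∨
          (a₁₂ + a₄₃ = a₃₁ + a₂₄ ∧
            g₅ = x₁ ^ a₃₁ * x₄ ^ a₂₄ - x₂ ^ a₁₂ * x₃ ^ a₄₃)) →
        IsMinimallyGeneratedBy (leastFormIdeal (toricIdeal K n))
          ![x₂ ^ a₁₂ * x₄ ^ a₁₄, x₃ ^ a₂₃ * x₄ ^ a₂₄, x₃ ^ a₃, x₄ ^ a₄, g₅, g₆]) := by
  subst hx₁ hx₂ hx₃ hx₄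
  obtain ⟨w1, w2, w3, w4, w5⟩ := hC.weight_eq
  obtain ⟨e3, e4⟩ := hC.exponent_eq hpos
  have h12 := hC.h12; have h14 := hC.h14; have h23 := hC.h23; have h24 := hC.h24
  have h31 := hC.h31; have h43' := hC.h43
  obtain ⟨k, hk⟩ := Nat.exists_eq_add_of_le h43
  constructor
  · intro h
    -- Rewrite `x_2^(a₂ + a₁₂)` by `f_2`, then `x_2^a₁₂ x_3^a₄₃` by `f_5`. Here `2 a₂₄ < a₁₄ + a₂₄ =
    -- a₄`.
    obtain ⟨hst, hmin⟩ := hC.standardBasis_and_tangentCone hpos hmono hCM h43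
      (r₀ := a₃₁) (r₂ := a₂₃ - a₄₃) (r₃ := 2 * a₂₄) (by omega) (by omega) (by omega) (by omega)
      (by rw [hk] at w2 ⊢; rw [Nat.add_sub_cancel_left]; linarith)
    refine ⟨hst, fun g₅ g₆ _ hg₆ hg₅ => hmin g₅ g₆ ?_ hg₅⟩
    rwa [← Nat.add_sub_assoc h43]
  · intro h
    obtain ⟨m, hm⟩ := Nat.exists_eq_add_of_le h
    -- Now `2 a₂₄ ≥ a₄`, so after `f_2` the factor `x_2^a₁₂ x_4^a₁₄` is rewritten by `f_1` instead.
    obtain ⟨hst, hmin⟩ := hC.standardBasis_and_tangentCone hpos hmono hCM h43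
      (r₀ := a₁) (r₂ := a₂₃) (r₃ := a₂₄ - a₁₄) (by omega) (by omega) (by omega) (by omega)
      (by rw [hm] at w2 ⊢; rw [Nat.add_sub_cancel_left]; linarith)
    refine ⟨hst, fun g₅ g₆ _ hg₆ hg₅ => hmin g₅ g₆ ?_ hg₅⟩
    rwa [← Nat.add_sub_assoc h]
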